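/- Let $G=(V,E)$ be a connected simple undirected graph, not necessarily finite, with graph distance $d$ and intervals $I(u,v)=\{w\in V: d(u,w)+d(w,v)=d(u,v)\}$. A profile is a finite sequence $\pi=(x_1,\dots,x_n)$ of vertices, $V^*$ is the set of all profiles, $F_\pi(v)=\sum_{i=1}^n d(v,x_i)$, and $\mathrm{Med}(\pi)$ is the set of vertices minimizing $F_\pi$. An ABC-function on $G$ is a map $L:V^*\to 2^V\setminus\{\varnothing\}$ such that: (A) $L(\pi)=L(\pi')$ whenever $\pi'$ is a permutation of $\pi$; (B) $L(u,v)=I(u,v)$ for all $u,v\in V$; (C) if $L(\pi)\cap L(\rho)\neq\varnothing$, then $L(\pi\rho)=L(\pi)\cap L(\rho)$, where $\pi\rho$ is the concatenation. $G$ is an ABC-graph if $\mathrm{Med}$ is an ABC-function on $G$ and is the only one. $G$ is weakly modular if for every vertex $u$: whenever $1=d(v,w)<d(u,v)=d(u,w)$, there is a common neighbor $x$ of $v,w$ with $d(u,x)=d(u,v)-1$; and whenever $d(v,z)=d(w,z)=1$ and $2=d(v,w)\le d(u,v)=d(u,w)=d(u,z)-1$, there is a common neighbor $x$ of $v,w$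 with $d(u,x)=d(u,v)-1$. Vertices $v_1,v_2,v_3$ form a metric triangle if $I(v_i,v_j)\cap I(v_i,v_k)=\{v_i\}$ whenever $\{i,j,k\}=\{1,2,3\}$; it is a quasi-median of $x,y,z$ if moreover $d(x,y)=d(x,v_1)+d(v_1,v_2)+d(v_2,y)$, $d(y,z)=d(y,v_2)+d(v_2,v_3)+d(v_3,z)$ and $d(z,x)=d(z,v_3)+d(v_3,v_1)+d(v_1,x)$. $G$ is modular if it is weakly modular and every quasi-median of every triplet of vertices satisfies $v_1=v_2=v_3$. $G$ has $G^2$-connected medians if for every profile $\pi$ the set $\mathrm{Med}(\pi)$ induces a connected subgraph of $G^2$, the graph on $V$ in which distinct $u,v$ are adjacent iff $d(u,v)\le 2$. $G$ is bipartite Helly if it is bipartite and every finite collection of nonempty pairwise intersecting half-balls has a nonempty intersection, where a half-ball is the intersection of a ball $\{x: d(v,x)\le r\}$ ($v\in V$, $r\in\mathbb{N}$) with one of the two color classes of $G$. **Theorem.** Every modular graph $G$ with $G^2$-connected medians is an ABC-graph. In particular, every bipartite Helly graph is an ABC-graph. -/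

import Mathlib

namespace ABCGraphs

variable {V : Type*} (G : SimpleGraph V)

/-- The interval `I(u,v)`: all vertices on shortest `(u,v)`-paths. -/
def interval (u v : V) : Set V :=
  {w | G.dist u w + G.dist w v = G.dist u v}

/-- The (closed) ball of radius `r` and center `v`. -/
def closedBall (v : V) (r : ℕ) : Set V :=
  {x | G.dist v x ≤ r}

/-! Weakly modular graphs and modular graphs. -/

/-- The triangle condition, for all basepoints. -/
def TriangleCondition : Prop :=
  ∀ u v w : V, G.dist v w = 1 → 1 < G.dist u v → G.dist u v = G.dist u w →
    ∃ x, G.Adj v x ∧ G.Adj w x ∧ G.dist u x + 1 = G.dist u v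

/-- The quadrangle condition, for all basepoints. -/
def QuadrangleCondition : Prop :=
  ∀ u v w z : V, G.dist v z = 1 → G.dist w z = 1 → G.dist v w = 2 →
    2 ≤ G.dist u v → G.dist u v = G.dist u w → G.dist u z = G.dist u v + 1 →
    ∃ x, G.Adj v x ∧ G.Adj w x ∧ G.dist u x + 1 = G.dist u v

def IsWeaklyModular : Prop :=
  TriangleCondition G ∧ QuadrangleCondition G

/-- The three intervals pairwise intersect only in the common end-vertices. -/
def IsMetricTriangle (v₁ v₂ v₃ : V) : Prop :=
  interval G v₁ v₂ ∩ interval G v₁ v₃ = {v₁} ∧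
  interval G v₂ v₁ ∩ interval G v₂ v₃ = {v₂} ∧
  interval G v₃ v₁ ∩ interval G v₃ v₂ = {v₃}

/-- The metric triangle `v₁ v₂ v₃` is a quasi-median of the triplet `x, y, z`. -/
structure IsQuasiMedian (x y z v₁ v₂ v₃ : V) : Prop where
  metricTriangle : IsMetricTriangle G v₁ v₂ v₃
  dist_xy : G.dist x y = G.dist x v₁ + G.dist v₁ v₂ + G.dist v₂ y
  dist_yz : G.dist y z = G.dist y v₂ + G.dist v₂ v₃ + G.dist v₃ z
  dist_zx : G.dist z x = G.dist z v₃ + G.dist v₃ v₁ + G.dist v₁ x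

/-- A weakly modular graph in which all quasi-medians are medians, i.e. have size zero. -/
def IsModular : Prop :=
  IsWeaklyModular G ∧
    ∀ x y z v₁ v₂ v₃ : V, IsQuasiMedian G x y z v₁ v₂ v₃ → v₁ = v₂ ∧ v₂ = v₃

/-! Bipartite Helly graphs. -/

/-- Every finite collection of pairwise intersecting members of the family `S` has a nonempty
intersection (each member being required to meet itself too, that is, to be nonempty). -/
def HasHellyProperty {X : Type*} (S : Set (Set X)) : Prop :=
  ∀ F : Set (Set X), F ⊆ S → F.Finite → (∀ A ∈ F, ∀ B ∈ F, (A ∩ B).Nonempty) →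
    (⋂₀ F).Nonempty

/-- The half-balls: intersections of a ball with one of the two colour classes. -/
def halfBalls (c : G.Coloring Bool) : Set (Set V) :=
  {H | ∃ (v : V) (r : ℕ) (b : Bool), H = closedBall G v r ∩ {x | c x = b}}

/-- `G` is bipartite and its half-balls have the Helly property. (The 2-colouring of a connected
bipartite graph is unique up to exchanging the two colours.) -/
def IsBipartiteHelly : Prop :=
  ∃ c : G.Coloring Bool, HasHellyProperty (halfBalls G c)

/-! Profiles (finite sequences of vertices), medians, consensus functions. -/

/-- The total distance `F_π(v)`. -/
noncomputable def totalDist (π : List V) (v : V) : ℕ :=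
  (π.map fun x => G.dist v x).sum

/-- The median function. -/
def med (π : List V) : Set V :=
  {v | ∀ w, totalDist G π v ≤ totalDist G π w}

/-- The `p`-th power of `G`: distinct vertices at distance at most `p` are adjacent. -/
def power (p : ℕ) : SimpleGraph V where
  Adj u v := u ≠ v ∧ G.dist u v ≤ p
  symm := ⟨fun _ _ h => ⟨h.1.symm, by rw [SimpleGraph.dist_comm]; exact h.2⟩⟩
  loopless := ⟨fun _ h => h.1 rfl⟩

/-- `G` has `G^p`-connected medians: every median set induces a connected subgraph of `G^p`. -/
def HasPowerConnectedMedians (p : ℕ) : Prop :=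
  ∀ π : List V, ((power G p).induce (med G π)).Connected

/-- `L` is a consensus function satisfying the axioms (A), (B) and (C). -/
structure IsABCFunction (L : List V → Set V) : Prop where
  nonempty : ∀ π, (L π).Nonempty
  anonymity : ∀ π ρ : List V, π.Perm ρ → L π = L ρ
  betweenness : ∀ u v : V, L [u, v] = interval G u v
  consistency : ∀ π ρ : List V, (L π ∩ L ρ).Nonempty → L (π ++ ρ) = L π ∩ L ρ

/-- The median function is an ABC-function, and it is the only one. -/
def IsABCGraph : Prop :=
  ∀ L : List V → Set V, IsABCFunction G L ↔ L = med G

end ABCGraphs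

namespace ABCGraphs

variable {V : Type*} {G : SimpleGraph V}

/-! Distances, intervals and medians of triplets. -/

/-! An ABC-function `L` sees distances only through intervals, so it is compared with the total
distance F locally. The goal is: if `u ∈ L π` and d(u,v) ≤ 2, then F(u) ≤ F(v), with `v ∈ L π` in
case of equality. By `HasPowerConnectedMedians.mem_med`, local minimality within radius 2 is global,
so `L π` lies in the median set; walks in G² inside that set then carry membership to every median.

The local comparison (`mem_of_card_le`) cancels votes. If u lies between x and v, then u and v both
belong to I(x,v), the value on the pair (x,v). Pairing each vertex beyond u with v and each vertex
beyond v with u gives a profile selecting v; regrouping it as the original profile, some pairs (u,v)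
and k surplus copies of u forces k = 0. For adjacent u, v nothing else is needed, since modular
graphs are bipartite.

At distance 2 there is a remainder ρ equidistant from u and v, which must be shown neutral once
pairs (u,v) are added. One may assume that no common neighbor beats u on ρ, as otherwise two
adjacent steps suffice. If some common neighbor ties with u, adjacent steps link u and v. Otherwise
copies of one vertex of ρ are traded for another until a tie occurs or the support shrinks; trading
in both directions yields two neutral profiles with a positive combination that is a multiple of ρ,
and ABC-functions ignore multiples (`isTied_of_leCommonNeighbors`).

In the bipartite Helly case, half-balls of suitable radii supply medians of triplets, hence
modularity. They also give, for medians u, v, points s and t two steps inward from each end with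
F(s) + F(t) ≤ F(u) + F(v), hence G²-connected medians. -/

theorem mem_interval {u v w : V} :
    w ∈ interval G u v ↔ G.dist u w + G.dist w v = G.dist u v := Iff.rfl

theorem left_mem_interval (u v : V) : u ∈ interval G u v := by simp [interval]

theorem right_mem_interval (u v : V) : v ∈ interval G u v := by simp [interval]

theorem exists_dist_eq (hG : G.Connected) {u v : V} {n : ℕ} (h : n ≤ G.dist u v) :
    ∃ w, G.dist u w = n ∧ G.dist w v + n = G.dist u v := by
  obtain ⟨p, hp⟩ := hG.exists_walk_length_eq_dist u v
  have h₁ := G.dist_le (p.take n)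
  have h₂ := G.dist_le (p.drop n)
  rw [SimpleGraph.Walk.take_length] at h₁
  rw [SimpleGraph.Walk.drop_length] at h₂
  have h₃ := hG.dist_triangle (u := u) (v := p.getVert n) (w := v)
  exact ⟨p.getVert n, by omega, by omega⟩

theorem exists_adj_dist_succ (hG : G.Connected) {u v : V} (h : u ≠ v) :
    ∃ w, G.Adj u w ∧ G.dist w v + 1 = G.dist u v := by
  obtain ⟨w, h₁, h₂⟩ := exists_dist_eq hG (n := 1) (hG.pos_dist_of_ne h)
  exact ⟨w, SimpleGraph.dist_eq_one_iff_adj.1 h₁, h₂⟩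

theorem exists_farthest (S : Set V) (hS : S.Nonempty) (x : V) (N : ℕ)
    (hN : ∀ s ∈ S, G.dist x s ≤ N) : ∃ s ∈ S, ∀ t ∈ S, G.dist x t ≤ G.dist x s := by
  obtain ⟨s, hs, hm⟩ := Set.Finite.exists_maximalFor' (fun s => G.dist x s) S
    ((Set.finite_Iic N).subset (by rintro _ ⟨s, hs, rfl⟩; exact hN s hs)) hS
  exact ⟨s, hs, fun t ht => (le_total (G.dist x s) (G.dist x t)).elim (hm ht) id⟩

/-- Every triplet of vertices of a connected graph has a quasi-median. -/
theorem exists_isQuasiMedian (hG : G.Connected) (x y z : V) :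
    ∃ v₁ v₂ v₃, IsQuasiMedian G x y z v₁ v₂ v₃ := by
  have tri := fun a b c : V => hG.dist_triangle (u := a) (v := b) (w := c)
  have comm := fun a b : V => G.dist_comm (u := a) (v := b)
  have key : ∀ a b c : V, ∃ w, G.dist a w + G.dist w b = G.dist a b ∧
      G.dist a w + G.dist w c = G.dist a c ∧ interval G w b ∩ interval G w c = {w} := by
    intro a b c
    -- Moving as far from a as possible inside both intervals leaves no further common step from w
    -- towards b and c.
    obtain ⟨w, ⟨hw₁, hw₂⟩, hm⟩ := exists_farthest (G := G) (interval G a b ∩ interval G a c)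
      ⟨a, left_mem_interval _ _, left_mem_interval _ _⟩ a (G.dist a b) (by
        rintro s ⟨hs, -⟩
        rw [mem_interval] at hs
        omega)
    rw [mem_interval] at hw₁ hw₂
    refine ⟨w, hw₁, hw₂, Set.Subset.antisymm ?_ ?_⟩
    · rintro t ⟨h₁, h₂⟩
      rw [mem_interval] at h₁ h₂
      have t₁ := tri a t b
      have t₂ := tri a w t
      have t₃ := tri a t c
      have := hm t ⟨by rw [mem_interval]; omega, by rw [mem_interval]; omega⟩
      exact (hG.dist_eq_zero_iff.1 (show G.dist w t = 0 by omega)).symm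
    · rintro _ rfl
      exact ⟨left_mem_interval _ _, left_mem_interval _ _⟩
  have mono : ∀ {a b c b' c' : V}, interval G a b ∩ interval G a c = {a} →
      G.dist a b' + G.dist b' b = G.dist a b → G.dist a c' + G.dist c' c = G.dist a c →
      interval G a b' ∩ interval G a c' = {a} := by
    intro a b c b' c' h hb hc
    refine Set.Subset.antisymm ?_ ?_
    · rintro t ⟨h₁, h₂⟩
      rw [mem_interval] at h₁ h₂
      rw [← h]
      have t₁ := tri t b' b
      have t₂ := tri t c' c
      have t₃ := tri a t b
      have t₄ := tri a t c
      exact ⟨by rw [mem_interval]; omega, by rw [mem_interval]; omega⟩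
    · rintro _ rfl
      exact ⟨left_mem_interval _ _, left_mem_interval _ _⟩
  obtain ⟨v₁, a₁, a₂, a₃⟩ := key x y z
  obtain ⟨v₂, b₁, b₂, b₃⟩ := key y v₁ z
  obtain ⟨v₃, c₁, c₂, c₃⟩ := key z v₁ v₂
  rw [comm y v₂, comm y v₁, comm v₂ v₁] at b₁
  rw [comm z v₃, comm z v₁, comm v₃ v₁] at c₁
  rw [comm z v₃, comm z v₂, comm v₃ v₂] at c₂
  refine ⟨v₁, v₂, v₃, ⟨mono a₃ (by omega) (by omega), mono b₃ ?_ (by omega), c₃⟩, ?_, ?_, ?_⟩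
  · simp
  · omega
  · rw [comm y v₂] at b₂ ⊢
    omega
  · rw [comm z x, comm z v₃, comm v₃ v₁, comm v₁ x]
    omega

theorem IsModular.exists_median (hm : IsModular G) (hG : G.Connected) (x y z : V) :
    ∃ m, G.dist x m + G.dist m y = G.dist x y ∧ G.dist y m + G.dist m z = G.dist y z ∧
      G.dist x m + G.dist m z = G.dist x z := by
  obtain ⟨m, v₂, v₃, h⟩ := exists_isQuasiMedian hG x y z
  obtain ⟨rfl, rfl⟩ := hm.2 _ _ _ _ _ _ h
  have h₁ := h.dist_xy
  have h₂ := h.dist_yz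
  have h₃ := h.dist_zx
  rw [G.dist_comm (u := z) (v := x), G.dist_comm (u := z) (v := m),
    G.dist_comm (u := m) (v := x)] at h₃
  simp only [SimpleGraph.dist_self] at h₁ h₂ h₃
  exact ⟨m, by omega, by omega, by omega⟩

/-- Three pairwise adjacent vertices form a metric triangle that is a quasi-median of itself, of
nonzero size. -/
theorem IsModular.not_triangle (hm : IsModular G) (hG : G.Connected) {u v w : V} (huv : G.Adj u v)
    (huw : G.Adj u w) (hvw : G.Adj v w) : False := by
  have key : ∀ {a b c : V}, G.Adj a b → G.Adj a c → G.Adj b c →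
      interval G a b ∩ interval G a c = {a} := by
    intro a b c hab hac hbc
    refine Set.Subset.antisymm ?_ ?_
    · rintro t ⟨h₁, h₂⟩
      rw [mem_interval, SimpleGraph.dist_eq_one_iff_adj.2 hab] at h₁
      rw [mem_interval, SimpleGraph.dist_eq_one_iff_adj.2 hac] at h₂
      rcases Nat.eq_zero_or_pos (G.dist a t) with h0 | hpos
      · exact (hG.dist_eq_zero_iff.1 h0).symm
      · have e₁ := hG.dist_eq_zero_iff.1 (show G.dist t b = 0 by omega)
        have e₂ := hG.dist_eq_zero_iff.1 (show G.dist t c = 0 by omega)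
        exact absurd (e₁.symm.trans e₂) hbc.ne
    · rintro _ rfl
      exact ⟨left_mem_interval _ _, left_mem_interval _ _⟩
  exact huv.ne (hm.2 u v w u v w ⟨⟨key huv huw hvw, key huv.symm hvw huw,
    key huw.symm hvw.symm huv⟩, by simp, by simp, by simp⟩).1

theorem IsModular.dist_ne_of_adj (hm : IsModular G) (hG : G.Connected) {u v : V}
    (h : G.Adj u v) (x : V) : G.dist x u ≠ G.dist x v := by
  intro he
  have h1 := SimpleGraph.dist_eq_one_iff_adj.2 h
  rcases lt_trichotomy (G.dist x u) 1 with h0 | h0 | h0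
  · have e₁ := hG.dist_eq_zero_iff.1 (show G.dist x u = 0 by omega)
    have e₂ := hG.dist_eq_zero_iff.1 (show G.dist x v = 0 by omega)
    exact h.ne (e₁.symm.trans e₂)
  · exact hm.not_triangle hG (SimpleGraph.dist_eq_one_iff_adj.1 h0)
      (SimpleGraph.dist_eq_one_iff_adj.1 (he ▸ h0)) h
  · obtain ⟨t, ht₁, ht₂, -⟩ := hm.1.1 x u v h1 h0 he
    exact hm.not_triangle hG h ht₁ ht₂

theorem IsModular.dist_adj_cases (hm : IsModular G) (hG : G.Connected) {u v : V}
    (h : G.Adj u v) (x : V) :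
    G.dist v x = G.dist u x + 1 ∨ G.dist u x = G.dist v x + 1 := by
  have h1 := hm.dist_ne_of_adj hG h x
  have h2 := SimpleGraph.dist_eq_one_iff_adj.2 h
  have h3 := hG.dist_triangle (u := x) (v := u) (w := v)
  have h4 := hG.dist_triangle (u := x) (v := v) (w := u)
  rw [G.dist_comm (u := v) (v := u)] at h4
  rw [G.dist_comm (u := v) (v := x), G.dist_comm (u := u) (v := x)]
  omega

/-! Total distances of multisets of vertices. -/

/-- The total distance from `v` to the members of the multiset `s`. -/
noncomputable def cost (G : SimpleGraph V) (s : Multiset V) (v : V) : ℕ :=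
  (s.map fun x => G.dist v x).sum

theorem cost_coe (l : List V) (v : V) : cost G (l : Multiset V) v = totalDist G l v := by
  simp [cost, totalDist]

@[simp] theorem cost_zero (v : V) : cost G 0 v = 0 := rfl

@[simp] theorem cost_cons (x : V) (s : Multiset V) (v : V) :
    cost G (x ::ₘ s) v = G.dist v x + cost G s v := by
  simp [cost]

@[simp] theorem cost_add (s t : Multiset V) (v : V) :
    cost G (s + t) v = cost G s v + cost G t v := by
  simp [cost]

@[simp] theorem cost_singleton (x v : V) : cost G {x} v = G.dist v x := by
  simp [cost]

@[simp] theorem cost_nsmul (n : ℕ) (s : Multiset V) (v : V) :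
    cost G (n • s) v = n * cost G s v := by
  simp [cost, Multiset.map_nsmul, Multiset.sum_nsmul]

theorem mem_med_iff (π : List V) (v : V) :
    v ∈ med G π ↔ ∀ w, cost G (π : Multiset V) v ≤ cost G (π : Multiset V) w := by
  simp only [cost_coe]
  rfl

theorem cost_eq_add_card {s : Multiset V} {u v : V} (k : ℕ)
    (h : ∀ x ∈ s, G.dist v x = G.dist u x + k) :
    cost G s v = cost G s u + k * Multiset.card s := by
  induction s using Multiset.induction_on with
  | empty => simp
  | cons x s ih =>
    have h₁ := h x (Multiset.mem_cons_self x s)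
    have h₂ := ih fun y hy => h y (Multiset.mem_cons_of_mem hy)
    rw [cost_cons, cost_cons, Multiset.card_cons, h₁, h₂]
    ring

theorem cost_le_add_card (hG : G.Connected) (s : Multiset V) (u v : V) :
    cost G s v ≤ cost G s u + G.dist v u * Multiset.card s := by
  induction s using Multiset.induction_on with
  | empty => simp
  | cons x s ih =>
    have := hG.dist_triangle (u := v) (v := u) (w := x)
    rw [cost_cons, cost_cons, Multiset.card_cons, mul_add]
    omega

theorem med_isABCFunction (hG : G.Connected) : IsABCFunction G (med G) where
  nonempty π := by
    have := hG.nonempty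
    obtain ⟨v, hv⟩ := exists_minimalFor_of_wellFoundedLT (fun _ : V => True)
      (totalDist G π) ⟨Classical.arbitrary V, trivial⟩
    exact ⟨v, fun w => (le_total (totalDist G π v) (totalDist G π w)).elim id (hv.2 trivial)⟩
  anonymity π ρ h := by
    ext v
    rw [mem_med_iff, mem_med_iff, Multiset.coe_eq_coe.2 h]
  betweenness u v := by
    ext w
    have key : ∀ t, totalDist G [u, v] t = G.dist u t + G.dist t v := by
      intro t
      simp [totalDist, G.dist_comm (u := u) (v := t)]
    constructor
    · intro h
      have h₁ := h u
      have h₂ := hG.dist_triangle (u := u) (v := w) (w := v)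
      rw [key, key, SimpleGraph.dist_self] at h₁
      rw [mem_interval]
      omega
    · intro h t
      rw [mem_interval] at h
      rw [key, key, h]
      exact hG.dist_triangle
  consistency π ρ := by
    rintro ⟨a, ha₁, ha₂⟩
    have key : ∀ t, totalDist G (π ++ ρ) t = totalDist G π t + totalDist G ρ t := by
      intro t
      simp [totalDist]
    ext t
    constructor
    · intro h
      have h₁ := h a
      have h₂ := ha₁ t
      have h₃ := ha₂ t
      rw [key, key] at h₁
      exact ⟨fun w => by have := ha₁ w; omega, fun w => by have := ha₂ w; omega⟩
    · rintro ⟨h₁, h₂⟩ w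
      rw [key, key]
      exact add_le_add (h₁ w) (h₂ w)

/-! Consensus functions on multisets of vertices. -/

/-- A consensus function on multisets of vertices satisfying betweenness and consistency. -/
structure IsABCMultisetFunction (G : SimpleGraph V) (M : Multiset V → Set V) : Prop where
  nonempty : ∀ s, (M s).Nonempty
  betweenness : ∀ u v : V, M ({u} + {v}) = interval G u v
  consistency : ∀ s t, (M s ∩ M t).Nonempty → M (s + t) = M s ∩ M t

theorem IsABCFunction.exists_multisetFunction {L : List V → Set V} (hL : IsABCFunction G L) :
    ∃ M, IsABCMultisetFunction G M ∧ ∀ π : List V, M π = L π := by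
  refine ⟨fun s => Quotient.liftOn s L hL.anonymity, ⟨?_, hL.betweenness, ?_⟩, fun _ => rfl⟩
  · intro s
    induction s using Quotient.inductionOn with
    | h π => exact hL.nonempty π
  · intro s t
    induction s using Quotient.inductionOn with
    | h π =>
      induction t using Quotient.inductionOn with
      | h ρ => exact hL.consistency π ρ

namespace IsABCMultisetFunction

variable {M : Multiset V → Set V} (hM : IsABCMultisetFunction G M)
include hM

theorem add_eq {s t : Multiset V} {a : V} (hs : a ∈ M s) (ht : a ∈ M t) :
    M (s + t) = M s ∩ M t :=
  hM.consistency s t ⟨a, hs, ht⟩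

theorem mem_add {s t : Multiset V} {a : V} (hs : a ∈ M s) (ht : a ∈ M t) : a ∈ M (s + t) := by
  rw [hM.add_eq hs ht]
  exact ⟨hs, ht⟩

/-- Adding the empty multiset changes nothing, so consistency applied at b ∈ `M 0` gives I(a,b) = `M
0` ∩ I(a,b), which contains a. -/
theorem mem_zero (a : V) : a ∈ M 0 := by
  obtain ⟨b, hb⟩ := hM.nonempty 0
  have hb' : b ∈ M ({a} + {b}) := by
    rw [hM.betweenness]
    exact right_mem_interval a b
  have h := hM.add_eq hb hb'
  rw [zero_add, hM.betweenness] at h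
  have ha := left_mem_interval (G := G) a b
  rw [h] at ha
  exact ha.1

theorem nsmul_succ_eq (s : Multiset V) (n : ℕ) : M ((n + 1) • s) = M s := by
  induction n with
  | zero => simp
  | succ n ih =>
    obtain ⟨a, ha⟩ := hM.nonempty s
    rw [succ_nsmul, hM.add_eq (ih ▸ ha) ha, ih, Set.inter_self]

theorem nsmul_eq (s : Multiset V) {n : ℕ} (hn : n ≠ 0) : M (n • s) = M s := by
  obtain ⟨k, rfl⟩ := Nat.exists_eq_succ_of_ne_zero hn
  exact hM.nsmul_succ_eq s k

theorem mem_nsmul {s : Multiset V} {a : V} (h : a ∈ M s) (n : ℕ) : a ∈ M (n • s) := by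
  rcases eq_or_ne n 0 with rfl | hn
  · rw [zero_nsmul]
    exact hM.mem_zero a
  · rwa [hM.nsmul_eq s hn]

theorem left_mem_pair (u v : V) : u ∈ M ({u} + {v}) := by
  rw [hM.betweenness]
  exact left_mem_interval u v

theorem right_mem_pair (u v : V) : v ∈ M ({u} + {v}) := by
  rw [hM.betweenness]
  exact right_mem_interval u v

theorem singleton_eq (hG : G.Connected) (v : V) : M {v} = {v} := by
  have h := hM.nsmul_succ_eq {v} 1
  rw [one_add_one_eq_two, two_nsmul, hM.betweenness] at h
  rw [← h]
  ext w
  rw [mem_interval, Set.mem_singleton_iff, SimpleGraph.dist_self, Nat.add_eq_zero_iff,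
    hG.dist_eq_zero_iff, hG.dist_eq_zero_iff]
  exact ⟨fun h => h.2, fun h => ⟨h.symm, h⟩⟩

/-- Since u is between x and v, I(u,v) ⊆ I(x,v): the whole interval is selected by each pair (x,v),
hence by their sum. -/
theorem mem_add_card_nsmul (hG : G.Connected) {u v w : V} (hw : w ∈ interval G u v)
    {s : Multiset V} (hs : ∀ x ∈ s, G.dist v x = G.dist u x + G.dist u v) :
    w ∈ M (s + Multiset.card s • {v}) := by
  induction s using Multiset.induction_on with
  | empty => simpa using hM.mem_zero w
  | cons x s ih =>
    have h₁ := ih fun y hy => hs y (Multiset.mem_cons_of_mem hy)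
    have h₂ : w ∈ M ({x} + {v}) := by
      have h := hs x (Multiset.mem_cons_self x s)
      have t₁ := hG.dist_triangle (u := x) (v := u) (w := w)
      have t₂ := hG.dist_triangle (u := x) (v := w) (w := v)
      rw [hM.betweenness, mem_interval]
      rw [mem_interval] at hw
      rw [G.dist_comm (u := v) (v := x), G.dist_comm (u := u) (v := x)] at h
      omega
    have h := hM.mem_add h₂ h₁
    have e : {x} + {v} + (s + Multiset.card s • {v}) =
        x ::ₘ s + Multiset.card (x ::ₘ s) • {v} := by
      rw [Multiset.card_cons, succ_nsmul, ← Multiset.singleton_add]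
      abel
    rwa [e] at h

/-- If `s` splits into a part beyond `u`, a part beyond `v` and a remainder which does not
distinguish `u` from `v`, then the sizes of the first two parts decide between `u` and `v`. -/
theorem mem_of_card_le (hG : G.Connected) {u v : V} (huv : u ≠ v) {su sv ρ : Multiset V} {a : ℕ}
    (hsu : ∀ x ∈ su, G.dist v x = G.dist u x + G.dist u v)
    (hsv : ∀ x ∈ sv, G.dist u x = G.dist v x + G.dist u v)
    (hρv : v ∈ M (ρ + a • ({u} + {v})))
    (hu : u ∈ M (su + sv + ρ)) (hcard : Multiset.card su ≤ Multiset.card sv) :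
    Multiset.card su = Multiset.card sv ∧ v ∈ M (su + sv + ρ) := by
  have hsv' : ∀ x ∈ sv, G.dist u x = G.dist v x + G.dist v u := by
    rwa [G.dist_comm (u := v)]
  have hv : v ∈ M ((su + Multiset.card su • {v}) + (sv + Multiset.card sv • {u}) +
      (ρ + a • ({u} + {v}))) :=
    hM.mem_add (hM.mem_add (hM.mem_add_card_nsmul hG (right_mem_interval u v) hsu)
      (hM.mem_add_card_nsmul hG (left_mem_interval v u) hsv')) hρv
  obtain ⟨k, hk⟩ := Nat.exists_eq_add_of_le hcard
  -- The same multiset regrouped: the given one, balanced pairs, and the surplus k = |sv| − |su| of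
  -- copies of u. All three parts select u, so v must be selected by each of them.
  have e : (su + Multiset.card su • {v}) + (sv + Multiset.card sv • {u}) +
      (ρ + a • ({u} + {v})) =
      (su + sv + ρ) + ((a + Multiset.card su) • ({u} + {v}) + k • {u}) := by
    rw [hk]
    simp only [add_nsmul, nsmul_add]
    abel
  have hpair := hM.mem_nsmul (hM.left_mem_pair u v) (a + Multiset.card su)
  have hsing : u ∈ M {u} := by
    rw [hM.singleton_eq hG]
    rfl
  have hk' := hM.mem_nsmul hsing k
  rw [e, hM.add_eq hu (hM.mem_add hpair hk'), hM.add_eq hpair hk'] at hv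
  refine ⟨?_, hv.1⟩
  rcases eq_or_ne k 0 with rfl | h0
  · exact hk.symm
  -- A nonzero surplus selects only u, so v = u.
  · have h := hv.2.2
    rw [hM.nsmul_eq _ h0, hM.singleton_eq hG] at h
    exact absurd h.symm huv

theorem cost_le_of_adj (hm : IsModular G) (hG : G.Connected) {s : Multiset V} {u v : V}
    (h : G.Adj u v) (hu : u ∈ M s) :
    cost G s u ≤ cost G s v ∧ (cost G s u = cost G s v → v ∈ M s) := by
  classical
  have h1 := SimpleGraph.dist_eq_one_iff_adj.2 h
  let p : V → Prop := fun x => G.dist v x = G.dist u x + 1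
  have hs : s.filter p + s.filter (fun x => ¬ p x) = s := Multiset.filter_add_not p s
  have hsu : ∀ x ∈ s.filter p, G.dist v x = G.dist u x + 1 :=
    fun x hx => (Multiset.mem_filter.1 hx).2
  have hsv : ∀ x ∈ s.filter (fun x => ¬ p x), G.dist u x = G.dist v x + 1 :=
    fun x hx => (hm.dist_adj_cases hG h x).resolve_left (Multiset.mem_filter.1 hx).2
  have c₁ := cost_eq_add_card 1 hsu
  have c₂ := cost_eq_add_card 1 hsv
  have e : ∀ w, cost G s w = cost G (s.filter p) w + cost G (s.filter fun x => ¬ p x) w := by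
    intro w
    rw [← cost_add, hs]
  by_cases hlt : cost G s u < cost G s v
  · exact ⟨hlt.le, fun h => absurd h hlt.ne⟩
  · rw [e, e] at hlt
    have key := hM.mem_of_card_le hG h.ne (su := s.filter p) (sv := s.filter fun x => ¬ p x)
      (ρ := 0) (a := 0) (by rwa [h1]) (by rwa [h1]) (by simpa using hM.mem_zero v)
      (by rwa [add_zero, hs]) (by omega)
    rw [add_zero, hs] at key
    refine ⟨?_, fun _ => key.2⟩
    rw [e, e]
    omega

end IsABCMultisetFunction

/-! Pairs of vertices at distance two in modular graphs. -/

theorem IsModular.exists_common_adj (hm : IsModular G) (hG : G.Connected) {u v x : V}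
    (huv : G.dist u v = 2) (hx : G.dist u x = G.dist v x) :
    ∃ z, G.Adj u z ∧ G.Adj v z ∧ G.dist z x + 1 = G.dist u x := by
  obtain ⟨z, h₁, h₂, h₃⟩ := hm.exists_median hG u v x
  rw [G.dist_comm (u := z) (v := v)] at h₁
  exact ⟨z, SimpleGraph.dist_eq_one_iff_adj.1 (by omega),
    SimpleGraph.dist_eq_one_iff_adj.1 (by omega), by omega⟩

/-- The first step from t towards the median of t, u, v approaches u and v at once. -/
theorem IsModular.exists_adj_closer (hm : IsModular G) (hG : G.Connected) {t u v : V}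
    (ht : t ∉ interval G u v) :
    ∃ w, G.Adj t w ∧ G.dist w u + 1 = G.dist t u ∧ G.dist w v + 1 = G.dist t v := by
  obtain ⟨m, h₁, h₂, h₃⟩ := hm.exists_median hG t u v
  have hne : t ≠ m := by
    rintro rfl
    exact ht h₂
  obtain ⟨w, hw₁, hw₂⟩ := exists_adj_dist_succ hG hne
  have h1 := SimpleGraph.dist_eq_one_iff_adj.2 hw₁
  have t₁ := hG.dist_triangle (u := w) (v := m) (w := u)
  have t₂ := hG.dist_triangle (u := w) (v := m) (w := v)
  have t₃ := hG.dist_triangle (u := t) (v := w) (w := u)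
  have t₄ := hG.dist_triangle (u := t) (v := w) (w := v)
  exact ⟨w, hw₁, by omega, by omega⟩

theorem mem_interval_of_dist_eq_two (hG : G.Connected) {u v t : V} (huv : G.dist u v = 2)
    (ht : t ∈ interval G u v) : t = u ∨ t = v ∨ G.Adj u t ∧ G.Adj v t := by
  rw [mem_interval, huv] at ht
  rcases lt_trichotomy (G.dist u t) 1 with h | h | h
  · exact .inl (hG.dist_eq_zero_iff.1 (show G.dist u t = 0 by omega)).symm
  · refine .inr (.inr ⟨SimpleGraph.dist_eq_one_iff_adj.1 h, ?_⟩)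
    exact (SimpleGraph.dist_eq_one_iff_adj.1 (show G.dist t v = 1 by omega)).symm
  · exact .inr (.inl (hG.dist_eq_zero_iff.1 (show G.dist t v = 0 by omega)))

theorem IsModular.even_cost (hm : IsModular G) (hG : G.Connected) {u z : V} (h : G.Adj u z)
    (s : Multiset V) : Even (cost G s z + cost G s u + Multiset.card s) := by
  induction s using Multiset.induction_on with
  | empty => simp
  | cons x s ih =>
    rw [cost_cons, cost_cons, Multiset.card_cons]
    rw [Nat.even_iff] at ih ⊢
    have := hm.dist_adj_cases hG h x
    omega

/-- No common neighbour of `u` and `v` has a smaller total distance than `u`. -/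
def LeCommonNeighbors (G : SimpleGraph V) (u v : V) (ρ : Multiset V) : Prop :=
  ∀ z, G.Adj u z → G.Adj v z → cost G ρ u ≤ cost G ρ z

/-- After adding sufficiently many copies of `u` and `v`, both are selected. -/
def IsTied (M : Multiset V → Set V) (u v : V) (ρ : Multiset V) : Prop :=
  ∃ a : ℕ, u ∈ M (ρ + a • ({u} + {v})) ∧ v ∈ M (ρ + a • ({u} + {v}))

namespace IsABCMultisetFunction

variable {M : Multiset V → Set V} (hM : IsABCMultisetFunction G M)
include hM

theorem isTied_zero (u v : V) : IsTied M u v 0 := by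
  refine ⟨0, ?_, ?_⟩ <;> simpa using hM.mem_zero _

theorem isTied_add {u v : V} {ρ ρ' : Multiset V} (h : IsTied M u v ρ) (h' : IsTied M u v ρ') :
    IsTied M u v (ρ + ρ') := by
  obtain ⟨a, hu, hv⟩ := h
  obtain ⟨a', hu', hv'⟩ := h'
  have e : ρ + ρ' + (a + a') • ({u} + {v}) =
      (ρ + a • ({u} + {v})) + (ρ' + a' • ({u} + {v})) := by
    rw [add_nsmul]
    abel
  refine ⟨a + a', ?_, ?_⟩ <;> rw [e]
  exacts [hM.mem_add hu hu', hM.mem_add hv hv']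

theorem isTied_nsmul {u v : V} {ρ : Multiset V} (h : IsTied M u v ρ) (n : ℕ) :
    IsTied M u v (n • ρ) := by
  induction n with
  | zero => simpa using hM.isTied_zero u v
  | succ n ih =>
    rw [succ_nsmul]
    exact hM.isTied_add ih h

/-- Multiples do not matter, and surplus pairs (u,v) are harmless because each selects both u and v.
-/
theorem isTied_of_nsmul {u v : V} {ρ : Multiset V} {n : ℕ} (hn : n ≠ 0)
    (h : IsTied M u v (n • ρ)) : IsTied M u v ρ := by
  obtain ⟨a, hu, hv⟩ := h
  obtain ⟨k, hk⟩ := Nat.exists_eq_add_of_le (Nat.le_mul_of_pos_left a (Nat.pos_of_ne_zero hn))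
  have e : n • (ρ + a • ({u} + {v})) = n • ρ + a • ({u} + {v}) + k • ({u} + {v}) := by
    rw [nsmul_add, ← mul_nsmul', hk, add_nsmul, add_assoc]
  refine ⟨a, ?_, ?_⟩ <;> rw [← hM.nsmul_eq _ hn, e]
  exacts [hM.mem_add hu (hM.mem_nsmul (hM.left_mem_pair u v) k),
    hM.mem_add hv (hM.mem_nsmul (hM.right_mem_pair u v) k)]

theorem isTied_of_cost_eq (hm : IsModular G) (hG : G.Connected) {u v : V}
    (huv : G.dist u v = 2) {ρ : Multiset V} (hρ : ∀ x ∈ ρ, G.dist u x = G.dist v x)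
    (hle : LeCommonNeighbors G u v ρ) {z : V} (hz₁ : G.Adj u z) (hz₂ : G.Adj v z)
    (hz : cost G ρ u = cost G ρ z) : IsTied M u v ρ := by
  -- With this many pairs, a step towards both u and v gains 2a, more than the |ρ| it can lose on ρ.
  -- So no selected vertex lies outside I(u,v).
  let a := Multiset.card ρ + 1
  have hc : cost G ρ v = cost G ρ u := by
    simpa using cost_eq_add_card 0 fun x hx => (hρ x hx).symm
  have hτ : ∀ w, cost G (ρ + a • ({u} + {v})) w =
      cost G ρ w + a * (G.dist w u + G.dist w v) := by
    intro w
    simp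
  have hτu := hτ u
  have hτv := hτ v
  have hadj : ∀ w, G.Adj u w → G.Adj v w →
      cost G (ρ + a • ({u} + {v})) w = cost G ρ w + a * 2 := by
    intro w h₁ h₂
    rw [hτ, SimpleGraph.dist_eq_one_iff_adj.2 h₁.symm, SimpleGraph.dist_eq_one_iff_adj.2 h₂.symm]
  rw [SimpleGraph.dist_self, huv, zero_add] at hτu
  rw [SimpleGraph.dist_self, G.dist_comm, huv, add_zero] at hτv
  have hτz := hadj z hz₁ hz₂
  have huz : u ∈ M (ρ + a • ({u} + {v})) → z ∈ M (ρ + a • ({u} + {v})) :=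
    fun h => (hM.cost_le_of_adj hm hG hz₁ h).2 (by omega)
  have hvz : v ∈ M (ρ + a • ({u} + {v})) → z ∈ M (ρ + a • ({u} + {v})) :=
    fun h => (hM.cost_le_of_adj hm hG hz₂ h).2 (by omega)
  have hzu : z ∈ M (ρ + a • ({u} + {v})) → u ∈ M (ρ + a • ({u} + {v})) :=
    fun h => (hM.cost_le_of_adj hm hG hz₁.symm h).2 (by omega)
  have hzv : z ∈ M (ρ + a • ({u} + {v})) → v ∈ M (ρ + a • ({u} + {v})) :=
    fun h => (hM.cost_le_of_adj hm hG hz₂.symm h).2 (by omega)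
  suffices h : z ∈ M (ρ + a • ({u} + {v})) from ⟨a, hzu h, hzv h⟩
  obtain ⟨t, ht⟩ := hM.nonempty (ρ + a • ({u} + {v}))
  by_cases hI : t ∈ interval G u v
  · rcases mem_interval_of_dist_eq_two hG huv hI with rfl | rfl | ⟨h₁, h₂⟩
    · exact huz ht
    · exact hvz ht
    · have h₃ := (hM.cost_le_of_adj hm hG h₁.symm ht).1
      have h₄ := hle t h₁ h₂
      have h₅ := hadj t h₁ h₂
      exact huz ((hM.cost_le_of_adj hm hG h₁.symm ht).2 (by omega))
  · exfalso
    obtain ⟨w, hw, hwu, hwv⟩ := hm.exists_adj_closer hG hI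
    have h₁ := (hM.cost_le_of_adj hm hG hw ht).1
    have h₂ := cost_le_add_card hG ρ t w
    rw [SimpleGraph.dist_eq_one_iff_adj.2 hw.symm, one_mul] at h₂
    rw [hτ, hτ, show G.dist t u + G.dist t v = (G.dist w u + G.dist w v) + 2 by omega,
      mul_add] at h₁
    omega

/-- Replacing copies of `y` by copies of `x` preserves `LeCommonNeighbors` until the two vertices
are tied. -/
theorem exists_isTied_shift (hm : IsModular G) (hG : G.Connected) {u v : V}
    (huv : G.dist u v = 2) {S : Set V} (hS : ∀ x ∈ S, G.dist u x = G.dist v x) {x y : V}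
    (hx : x ∈ S) (hy : y ∈ S) (hxy : x ≠ y)
    (ih : ∀ ρ : Multiset V, (∀ w ∈ ρ, w ∈ S ∧ w ≠ y) → LeCommonNeighbors G u v ρ → IsTied M u v ρ)
    {σ : Multiset V} (hσ : ∀ w ∈ σ, w ∈ S ∧ w ≠ y) (q : ℕ) :
    ∀ p : ℕ, LeCommonNeighbors G u v (p • {x} + q • {y} + σ) →
      Even (p + q + Multiset.card σ) →
      ∃ t ≤ q, IsTied M u v ((p + t) • {x} + (q - t) • {y} + σ) := by
  induction q with
  | zero =>
    intro p hle _
    refine ⟨0, le_rfl, ih _ ?_ hle⟩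
    intro w hw
    simp only [add_zero, Nat.sub_self, zero_nsmul, Multiset.mem_add] at hw
    rcases hw with hw | hw
    · rw [Multiset.mem_singleton.1 (Multiset.mem_of_mem_nsmul hw)]
      exact ⟨hx, hxy⟩
    · exact hσ w hw
  | succ q ihq =>
    intro p hle hev
    by_cases htight : ∃ z, G.Adj u z ∧ G.Adj v z ∧
        cost G (p • {x} + (q + 1) • {y} + σ) u = cost G (p • {x} + (q + 1) • {y} + σ) z
    · obtain ⟨z, hz₁, hz₂, hz⟩ := htight
      refine ⟨0, Nat.zero_le _, hM.isTied_of_cost_eq hm hG huv ?_ hle hz₁ hz₂ hz⟩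
      intro w hw
      apply hS
      simp only [Multiset.mem_add] at hw
      rcases hw with (hw | hw) | hw
      · rwa [Multiset.mem_singleton.1 (Multiset.mem_of_mem_nsmul hw)]
      · rwa [Multiset.mem_singleton.1 (Multiset.mem_of_mem_nsmul hw)]
      · exact (hσ w hw).1
    · push Not at htight
      -- The gap between z and u is even, as the profile has even size, and positive, as there is no
      -- tie; so it is at least 2. Trading one y for one x lowers it by at most 2.
      have hle' : LeCommonNeighbors G u v ((p + 1) • {x} + q • {y} + σ) := by
        intro z hz₁ hz₂
        have h₁ := hle z hz₁ hz₂
        have h₂ := htight z hz₁ hz₂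
        have h₃ := hm.even_cost hG hz₁ (p • {x} + (q + 1) • {y} + σ)
        have hcard : Multiset.card (p • {x} + (q + 1) • {y} + σ) =
            p + (q + 1) + Multiset.card σ := by simp
        have h₄ := hm.dist_adj_cases hG hz₁ x
        have h₅ := hm.dist_adj_cases hG hz₁ y
        rw [hcard] at h₃
        rw [Nat.even_iff] at h₃ hev
        simp only [cost_add, cost_nsmul, cost_singleton, add_mul, one_mul] at h₁ h₂ h₃ ⊢
        omega
      obtain ⟨t, ht, hT⟩ := ihq (p + 1) hle' (by convert hev using 1; ring)
      refine ⟨t + 1, by omega, ?_⟩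
      rwa [show p + (t + 1) = p + 1 + t by ring, Nat.add_sub_add_right]

theorem isTied_of_leCommonNeighbors (hm : IsModular G) (hG : G.Connected) {u v : V}
    (huv : G.dist u v = 2) (S : Finset V) :
    (∀ x ∈ S, G.dist u x = G.dist v x) → ∀ ρ : Multiset V, (∀ x ∈ ρ, x ∈ S) →
      LeCommonNeighbors G u v ρ → IsTied M u v ρ := by
  classical
  induction S using Finset.strongInduction with
  | H S ih =>
  intro hS ρ hρ hle
  rcases Multiset.empty_or_exists_mem ρ with rfl | ⟨x, hx⟩
  · exact hM.isTied_zero u v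
  have herase : ∀ y ∈ S, ∀ ρ : Multiset V, (∀ w ∈ ρ, w ∈ (S : Set V) ∧ w ≠ y) →
      LeCommonNeighbors G u v ρ → IsTied M u v ρ := fun y hy ρ hρ =>
    ih (S.erase y) (Finset.erase_ssubset hy) (fun w hw => hS w (Finset.mem_of_mem_erase hw)) ρ
      fun w hw => Finset.mem_erase.2 ⟨(hρ w hw).2, (hρ w hw).1⟩
  by_cases hy : ∃ y ∈ ρ, y ≠ x
  · obtain ⟨y, hy, hyx⟩ := hy
    -- Doubling ρ provides the even size needed for the parity argument of the shift.
    let σ := 2 • ρ.filter fun w => w ≠ x ∧ w ≠ y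
    have hσ : ∀ w ∈ σ, w ∈ S ∧ w ≠ x ∧ w ≠ y := by
      intro w hw
      have h := Multiset.mem_filter.1 (Multiset.mem_of_mem_nsmul hw)
      exact ⟨hρ w h.1, h.2⟩
    have hdec : 2 • ρ = (2 * ρ.count x) • {x} + (2 * ρ.count y) • {y} + σ := by
      ext w
      simp only [σ, Multiset.count_add, Multiset.count_nsmul, Multiset.count_singleton,
        Multiset.count_filter]
      by_cases h₁ : w = x
      · subst h₁
        simp [Ne.symm hyx]
      · by_cases h₂ : w = y
        · subst h₂
          simp [hyx]
        · simp [h₁, h₂]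
    have hle₂ : LeCommonNeighbors G u v (2 • ρ) := by
      intro z hz₁ hz₂
      rw [cost_nsmul, cost_nsmul]
      exact Nat.mul_le_mul_left 2 (hle z hz₁ hz₂)
    have hev : Even (2 * ρ.count x + 2 * ρ.count y + Multiset.card σ) := by
      simp [σ, Nat.even_add]
    obtain ⟨t, ht, hT⟩ := hM.exists_isTied_shift hm hG huv (S := S) hS (hρ x hx) (hρ y hy)
      hyx.symm (herase y (hρ y hy)) (fun w hw => ⟨(hσ w hw).1, (hσ w hw).2.2⟩) _ _
      (hdec ▸ hle₂) hev
    obtain ⟨t', ht', hT'⟩ := hM.exists_isTied_shift hm hG huv (S := S) hS (hρ y hy) (hρ x hx)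
      hyx (herase x (hρ x hx)) (fun w hw => ⟨(hσ w hw).1, (hσ w hw).2.1⟩) (2 * ρ.count x)
      (2 * ρ.count y)
      (by rwa [hdec, add_comm ((2 * ρ.count x) • ({x} : Multiset V))] at hle₂)
      (by rwa [add_comm (2 * ρ.count y)])
    rcases eq_or_ne t 0 with rfl | ht0
    · rw [add_zero, Nat.sub_zero, ← hdec] at hT
      exact hM.isTied_of_nsmul two_ne_zero hT
    · refine hM.isTied_of_nsmul (n := (t + t') * 2) (by omega) ?_
      have h := hM.isTied_add (hM.isTied_nsmul hT t') (hM.isTied_nsmul hT' t)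
      -- The weights t' and t make the opposite shifts, of t and t' copies, cancel.
      have e : t' • ((2 * ρ.count x + t) • {x} + (2 * ρ.count y - t) • {y} + σ) +
          t • ((2 * ρ.count y + t') • {y} + (2 * ρ.count x - t') • {x} + σ) =
          ((t + t') * 2) • ρ := by
        rw [mul_nsmul', hdec]
        obtain ⟨r, hr⟩ := Nat.exists_eq_add_of_le ht
        obtain ⟨r', hr'⟩ := Nat.exists_eq_add_of_le ht'
        rw [hr, hr', Nat.add_sub_cancel_left, Nat.add_sub_cancel_left]
        module
      rwa [e] at h
  · push Not at hy
    exfalso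
    -- Here ρ consists of copies of x alone, and a common neighbor closer to x beats u.
    obtain ⟨z, hz₁, hz₂, hz⟩ := hm.exists_common_adj hG huv (hS x (hρ x hx))
    have h := cost_eq_add_card (G := G) (s := ρ) (u := z) (v := u) 1 fun w hw => by
      rw [hy w hw, hz]
    have hpos := Multiset.card_pos_iff_exists_mem.2 ⟨x, hx⟩
    have := hle z hz₁ hz₂
    omega

theorem cost_le_of_dist_eq_two (hm : IsModular G) (hG : G.Connected) {s : Multiset V} {u v : V}
    (huv : G.dist u v = 2) (hu : u ∈ M s) :
    cost G s u ≤ cost G s v ∧ (cost G s u = cost G s v → v ∈ M s) := by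
  classical
  by_cases hlt : cost G s u < cost G s v
  · exact ⟨hlt.le, fun h => absurd h hlt.ne⟩
  push Not at hlt
  -- If such a z exists, two adjacent comparisons reach v through z. If none exists, the larger part
  -- beyond v already favors z, so ρ alone must penalize it.
  by_cases hz : ∃ z, G.Adj u z ∧ G.Adj v z ∧ cost G s z ≤ cost G s u
  · obtain ⟨z, hz₁, hz₂, hz⟩ := hz
    have h₁ := hM.cost_le_of_adj hm hG hz₁ hu
    have h₂ := hM.cost_le_of_adj hm hG hz₂.symm (h₁.2 (by omega))
    exact ⟨by omega, fun _ => h₂.2 (by omega)⟩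
  push Not at hz
  let p : V → Prop := fun x => G.dist v x = G.dist u x + 2
  let p' : V → Prop := fun x => G.dist u x = G.dist v x + 2
  let su := s.filter p
  let sv := (s.filter fun x => ¬ p x).filter p'
  let ρ := (s.filter fun x => ¬ p x).filter fun x => ¬ p' x
  have hs : su + sv + ρ = s := by
    rw [add_assoc, Multiset.filter_add_not, Multiset.filter_add_not]
  have hsu : ∀ x ∈ su, G.dist v x = G.dist u x + 2 := fun x hx => (Multiset.mem_filter.1 hx).2
  have hsv : ∀ x ∈ sv, G.dist u x = G.dist v x + 2 := fun x hx => (Multiset.mem_filter.1 hx).2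
  obtain ⟨z₀, hz₀, hz₀'⟩ := exists_dist_eq hG (u := u) (v := v) (n := 1) (by omega)
  have hz₀'' := SimpleGraph.dist_eq_one_iff_adj.1 (show G.dist z₀ v = 1 by omega)
  rw [SimpleGraph.dist_eq_one_iff_adj] at hz₀
  have hρ : ∀ x ∈ ρ, G.dist u x = G.dist v x := by
    intro x hx
    obtain ⟨hx, h₁⟩ := Multiset.mem_filter.1 hx
    have h₂ := (Multiset.mem_filter.1 hx).2
    have h₃ := hm.dist_adj_cases hG hz₀ x
    have h₄ := hm.dist_adj_cases hG hz₀'' x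
    simp only [p, p'] at h₁ h₂
    omega
  have e : ∀ w, cost G s w = cost G su w + cost G sv w + cost G ρ w := by
    intro w
    rw [← cost_add, ← cost_add, hs]
  have c₁ := cost_eq_add_card 2 hsu
  have c₂ := cost_eq_add_card 2 hsv
  have c₃ : cost G ρ v = cost G ρ u := by
    simpa using cost_eq_add_card 0 fun x hx => (hρ x hx).symm
  have hcard : Multiset.card su ≤ Multiset.card sv := by
    rw [e, e] at hlt
    omega
  have hle : LeCommonNeighbors G u v ρ := by
    intro z hz₁ hz₂
    have h := hz z hz₁ hz₂
    have d₁ : cost G su z = cost G su u + 1 * Multiset.card su := by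
      refine cost_eq_add_card 1 fun x hx => ?_
      have h₁ := hm.dist_adj_cases hG hz₁ x
      have h₂ := hm.dist_adj_cases hG hz₂ x
      have h₃ := hsu x hx
      omega
    have d₂ : cost G sv u = cost G sv z + 1 * Multiset.card sv := by
      refine cost_eq_add_card 1 fun x hx => ?_
      have h₁ := hm.dist_adj_cases hG hz₁ x
      have h₂ := hm.dist_adj_cases hG hz₂ x
      have h₃ := hsv x hx
      omega
    rw [e, e] at h
    omega
  obtain ⟨a, -, hv⟩ := hM.isTied_of_leCommonNeighbors hm hG huv ρ.toFinset
    (fun x hx => hρ x (Multiset.mem_toFinset.1 hx)) ρ (fun x hx => Multiset.mem_toFinset.2 hx) hle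
  have hne : u ≠ v := by
    rintro rfl
    simp at huv
  have key := hM.mem_of_card_le hG hne (su := su) (sv := sv) (by rwa [huv]) (by rwa [huv]) hv
    (by rwa [hs]) hcard
  rw [hs] at key
  refine ⟨?_, fun _ => key.2⟩
  rw [e, e]
  omega

end IsABCMultisetFunction

/-! Graphs with `G^p`-connected medians. -/

/-- If medians are connected in `G^p`, then a vertex minimizing the total distance within the ball
of radius `p` around it is a median. -/
theorem HasPowerConnectedMedians.mem_med {p : ℕ} (h : HasPowerConnectedMedians G p)
    (hG : G.Connected) {π : List V} {u : V}
    (hu : ∀ w, G.dist u w ≤ p → totalDist G π u ≤ totalDist G π w) : u ∈ med G π := by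
  by_contra hmed
  obtain ⟨w₀, hw₀⟩ : ∃ w, totalDist G π w < totalDist G π u := by
    simpa [med] using hmed
  set N := totalDist G π u with hN
  have hpos : ∀ w, totalDist G π w < N → 0 < G.dist w u := fun w hw =>
    hG.pos_dist_of_ne fun he => by rw [he] at hw; exact lt_irrefl _ hw
  let T : Set (ℕ × ℕ) := {x | ∃ w, totalDist G π w < N ∧ G.dist w u ≤ N * G.dist w₀ u ∧
    x = (N - totalDist G π w, G.dist w u)}
  have hT : T.Finite := by
    refine ((Set.finite_Iic N).prod (Set.finite_Iic (N * G.dist w₀ u))).subset ?_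
    rintro _ ⟨w, -, hw, rfl⟩
    exact ⟨Nat.sub_le _ _, hw⟩
  have hw₀T : (N - totalDist G π w₀, G.dist w₀ u) ∈ T :=
    ⟨w₀, hw₀, Nat.le_mul_of_pos_left _ (by omega), rfl⟩
  -- The vertex v maximizes the slope (F(u) − F(v))/d(v,u). The distance cutoff makes the set of
  -- candidate pairs finite even if V is infinite; beyond it the slope is below 1/d(w₀,u), hence
  -- below that of w₀.
  obtain ⟨_, ⟨v, hv, -, rfl⟩, hmax⟩ :=
    T.exists_max_image (fun x => (x.1 : ℚ) / x.2) hT ⟨_, hw₀T⟩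
  have hslope : ∀ w, totalDist G π w < N →
      (N - totalDist G π w) * G.dist v u ≤ (N - totalDist G π v) * G.dist w u := by
    have hvq : (0 : ℚ) < G.dist v u := by exact_mod_cast hpos v hv
    have cross : ∀ w, totalDist G π w < N → (N - totalDist G π w, G.dist w u) ∈ T →
        (N - totalDist G π w) * G.dist v u ≤ (N - totalDist G π v) * G.dist w u := by
      intro w hw hwT
      have h := hmax _ hwT
      have hwq : (0 : ℚ) < G.dist w u := by exact_mod_cast hpos w hw
      simp only at h
      rw [div_le_div_iff₀ hwq hvq] at h
      exact_mod_cast h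
    intro w hw
    by_cases hd : G.dist w u ≤ N * G.dist w₀ u
    · exact cross w hw ⟨w, hw, hd, rfl⟩
    · have h₀ := cross w₀ hw₀ hw₀T
      calc (N - totalDist G π w) * G.dist v u ≤ N * G.dist v u :=
            Nat.mul_le_mul_right _ (Nat.sub_le _ _)
        _ ≤ N * ((N - totalDist G π w₀) * G.dist v u) :=
            Nat.mul_le_mul_left _ (Nat.le_mul_of_pos_left _ (by omega))
        _ ≤ N * ((N - totalDist G π v) * G.dist w₀ u) := Nat.mul_le_mul_left _ h₀
        _ = (N - totalDist G π v) * (N * G.dist w₀ u) := by ring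
        _ ≤ (N - totalDist G π v) * G.dist w u := Nat.mul_le_mul_left _ (by omega)
  -- Copies of u weighted by the maximal slope raise v exactly to the level of u, so both become
  -- medians. The first vertex after u on a walk to v in the median set is then strictly better than
  -- u on π, yet within distance p.
  let s : Multiset V := G.dist v u • (π : Multiset V) + (N - totalDist G π v) • {u}
  have hcost : ∀ w, totalDist G s.toList w =
      G.dist v u * totalDist G π w + (N - totalDist G π v) * G.dist w u := by
    intro w
    rw [← cost_coe, Multiset.coe_toList]
    simp [s, cost_coe]
  have hcu : totalDist G s.toList u = G.dist v u * N := by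
    rw [hcost, SimpleGraph.dist_self, mul_zero, add_zero]
  have hmin : ∀ w, G.dist v u * N ≤ totalDist G s.toList w := by
    intro w
    rw [hcost]
    rcases lt_or_ge (totalDist G π w) N with hw | hw
    · have h₁ := hslope w hw
      have e : G.dist v u * N =
          G.dist v u * totalDist G π w + (N - totalDist G π w) * G.dist v u := by
        rw [mul_comm (N - _), ← mul_add, Nat.add_sub_cancel' hw.le]
      omega
    · exact (Nat.mul_le_mul_left _ hw).trans (Nat.le_add_right _ _)
  have humed : u ∈ med G s.toList := fun w => hcu.le.trans (hmin w)
  have hvmed : v ∈ med G s.toList := by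
    intro w
    refine le_trans (le_of_eq ?_) (hmin w)
    rw [hcost, mul_comm (N - _), ← mul_add, Nat.add_sub_cancel' hv.le]
  have hne : u ≠ v := by
    rintro rfl
    exact lt_irrefl _ hv
  obtain ⟨W⟩ := (h s.toList).preconnected ⟨u, humed⟩ ⟨v, hvmed⟩
  cases W with
  | nil => exact hne rfl
  | @cons _ w _ hadj _ =>
    obtain ⟨hne', hle⟩ := hadj
    have h₁ := w.2 u
    rw [hcu, hcost] at h₁
    have h₂ := hu w hle
    have h₃ : 0 < (N - totalDist G π v) * G.dist (w : V) u :=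
      Nat.mul_pos (by omega) (hG.pos_dist_of_ne (Ne.symm hne'))
    have h₄ := Nat.mul_le_mul_left (G.dist v u) h₂
    omega

/-! ### From local comparisons to uniqueness of the consensus function. -/

theorem IsModular.isABCGraph (hm : IsModular G) (hG : G.Connected)
    (h : HasPowerConnectedMedians G 2) : IsABCGraph G := by
  intro L
  refine ⟨fun hL => ?_, fun hL => hL ▸ med_isABCFunction hG⟩
  obtain ⟨M, hM, hML⟩ := hL.exists_multisetFunction
  have hloc : ∀ (π : List V) (u v : V), u ∈ L π → G.dist u v ≤ 2 →
      totalDist G π u ≤ totalDist G π v ∧ (totalDist G π u = totalDist G π v → v ∈ L π) := by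
    intro π u v hu hd
    rw [← hML] at hu ⊢
    rw [← cost_coe, ← cost_coe]
    rcases lt_trichotomy (G.dist u v) 1 with hd' | hd' | hd'
    · have := hG.dist_eq_zero_iff.1 (show G.dist u v = 0 by omega)
      subst this
      exact ⟨le_rfl, fun _ => hu⟩
    · exact hM.cost_le_of_adj hm hG (SimpleGraph.dist_eq_one_iff_adj.1 hd') hu
    · exact hM.cost_le_of_dist_eq_two hm hG (by omega) hu
  have hsub : ∀ π, L π ⊆ med G π := fun π u hu =>
    h.mem_med hG fun w hw => (hloc π u w hu hw).1
  funext π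
  refine (hsub π).antisymm fun v hv => ?_
  obtain ⟨u, hu⟩ := hL.nonempty π
  have key : ∀ (a b : med G π), ((power G 2).induce (med G π)).Walk a b →
      (a : V) ∈ L π → (b : V) ∈ L π := by
    intro a b W
    induction W with
    | nil => exact id
    | @cons a c b hadj _ ih =>
      exact fun ha => ih ((hloc π a c ha hadj.2).2 (le_antisymm (a.2 c) (c.2 a)))
  obtain ⟨W⟩ := (h π).preconnected ⟨u, hsub π hu⟩ ⟨v, hv⟩
  exact key _ _ W hu

/-! Bipartite Helly graphs. -/

theorem even_dist_iff (hG : G.Connected) (c : G.Coloring Bool) (u v : V) :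
    Even (G.dist u v) ↔ c u = c v := by
  obtain ⟨p, hp⟩ := hG.exists_walk_length_eq_dist u v
  rw [← hp, c.even_length_iff_congr p, Bool.coe_iff_coe]

theorem even_dist_add_dist_add_dist (hG : G.Connected) (c : G.Coloring Bool) (x y z : V) :
    Even (G.dist x y + G.dist y z + G.dist x z) := by
  rw [Nat.even_add, Nat.even_add, even_dist_iff hG c, even_dist_iff hG c, even_dist_iff hG c]
  cases c x <;> cases c y <;> cases c z <;> simp

theorem inter_halfBalls_nonempty (hG : G.Connected) [Nontrivial V] (c : G.Coloring Bool)
    {x y z : V} {r s : ℕ} (hr : Even (r + G.dist x z)) (hs : Even (s + G.dist y z))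
    (h : G.dist x y ≤ r + s) :
    ∃ w, G.dist x w ≤ r ∧ G.dist y w ≤ s ∧ c w = c z := by
  have par := even_dist_add_dist_add_dist hG c
  have e := par x y z
  rw [Nat.even_iff] at hr hs e
  simp only [← even_dist_iff hG c, Nat.even_iff]
  rcases le_or_gt r (G.dist x y) with hle | hlt
  · obtain ⟨w, h₁, h₂⟩ := exists_dist_eq hG hle
    have e' := Nat.even_iff.1 (par x w z)
    refine ⟨w, h₁.le, ?_, ?_⟩
    · rw [G.dist_comm]
      omega
    · omega
  · rcases Nat.even_or_odd s with hs' | hs'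
    · rw [Nat.even_iff] at hs'
      exact ⟨y, by omega, by simp, by omega⟩
    -- For odd s the center y has the wrong color, so a neighbor replaces it; this is where a second
    -- vertex is needed.
    · obtain ⟨w, hw⟩ := hG.preconnected.exists_adj_of_nontrivial y
      have h1 := SimpleGraph.dist_eq_one_iff_adj.2 hw
      have e' := Nat.even_iff.1 (par y w z)
      have t := hG.dist_triangle (u := x) (v := y) (w := w)
      rw [Nat.odd_iff] at hs'
      exact ⟨w, by omega, by omega, by omega⟩

/-- In a bipartite Helly graph, balls with compatible parities which are large enough to meet
pairwise have a common vertex. -/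
theorem exists_mem_balls (hG : G.Connected) [Nontrivial V] {c : G.Coloring Bool}
    (hH : HasHellyProperty (halfBalls G c)) {S : Set (V × ℕ)} (hS : S.Finite) (z : V)
    (hpar : ∀ p ∈ S, Even (p.2 + G.dist p.1 z))
    (h : ∀ p ∈ S, ∀ q ∈ S, G.dist p.1 q.1 ≤ p.2 + q.2) :
    ∃ w, ∀ p ∈ S, G.dist p.1 w ≤ p.2 := by
  obtain ⟨w, hw⟩ := hH ((fun p => closedBall G p.1 p.2 ∩ {w | c w = c z}) '' S)
    (by rintro _ ⟨p, -, rfl⟩; exact ⟨p.1, p.2, c z, rfl⟩) (hS.image _) (by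
      rintro _ ⟨p, hp, rfl⟩ _ ⟨q, hq, rfl⟩
      obtain ⟨w, h₁, h₂, h₃⟩ := inter_halfBalls_nonempty hG c (hpar p hp) (hpar q hq) (h p hp q hq)
      exact ⟨w, ⟨h₁, h₃⟩, h₂, h₃⟩)
  exact ⟨w, fun p hp => (hw _ ⟨p, hp, rfl⟩).1⟩

theorem exists_mem_three_balls (hG : G.Connected) [Nontrivial V] {c : G.Coloring Bool}
    (hH : HasHellyProperty (halfBalls G c)) {x y z : V} {r s t : ℕ} (hxy : G.dist x y ≤ r + s)
    (hxz : G.dist x z ≤ r + t) (hyz : G.dist y z ≤ s + t) (a : V) (hr : Even (r + G.dist x a))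
    (hs : Even (s + G.dist y a)) (ht : Even (t + G.dist z a)) :
    ∃ w, G.dist x w ≤ r ∧ G.dist y w ≤ s ∧ G.dist z w ≤ t := by
  have comm := fun a b : V => G.dist_comm (u := a) (v := b)
  obtain ⟨w, hw⟩ := exists_mem_balls hG hH (S := {(x, r), (y, s), (z, t)})
    (by simp) a (by
      rintro _ (rfl | rfl | rfl) <;> assumption) (by
      rintro _ (rfl | rfl | rfl) _ (rfl | rfl | rfl)
      · simp
      · exact hxy
      · exact hxz
      · rwa [comm, add_comm]
      · simp
      · exact hyz
      · rwa [comm, add_comm]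
      · rwa [comm, add_comm]
      · simp)
  exact ⟨w, hw (x, r) (by simp), hw (y, s) (by simp), hw (z, t) (by simp)⟩

theorem IsBipartiteHelly.isModular (h : IsBipartiteHelly G) (hG : G.Connected) :
    IsModular G := by
  obtain ⟨c, hH⟩ := h
  have comm := fun a b : V => G.dist_comm (u := a) (v := b)
  have tri := fun a b c : V => hG.dist_triangle (u := a) (v := b) (w := c)
  have par := fun a b d : V => Nat.even_iff.1 (even_dist_add_dist_add_dist hG c a b d)
  refine ⟨⟨?_, ?_⟩, ?_⟩
  · intro u v w h₁ _ h₂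
    have := par u v w
    omega
  · intro u v w z hvz hwz hvw h₂ huv huz
    have : Nontrivial V := ⟨v, w, fun he => by simp [he] at hvw⟩
    obtain ⟨x, h₃, h₄, h₅⟩ := exists_mem_three_balls hG hH (x := v) (y := w) (z := u) (r := 1)
      (s := 1) (t := G.dist u v - 1) (by omega) (by rw [comm]; omega) (by rw [comm]; omega) z
      (by rw [hvz]; decide) (by rw [hwz]; decide) (by rw [huz, Nat.even_iff]; omega)
    have t₁ := tri u x v
    have t₂ := tri u x w
    rw [comm x v] at t₁
    rw [comm x w] at t₂
    exact ⟨x, SimpleGraph.dist_eq_one_iff_adj.1 (by omega),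
      SimpleGraph.dist_eq_one_iff_adj.1 (by omega), by omega⟩
  · intro _ _ _ x y z hq
    obtain ⟨h₁, h₂, h₃⟩ := hq.metricTriangle
    rcases subsingleton_or_nontrivial V with hV | hV
    · exact ⟨Subsingleton.elim _ _, Subsingleton.elim _ _⟩
    have p := par x y z
    have t₁ := tri x y z
    have t₂ := tri x z y
    have t₃ := tri y x z
    rw [comm z y] at t₂
    rw [comm y x] at t₃
    -- The radii are the Gromov products, integral because closed walks are even. They make all
    -- three pairwise ball conditions tight, so a common point is a median, which the metric
    -- triangle forces to be each corner.
    obtain ⟨r, hr⟩ : ∃ r, G.dist x y + G.dist x z = G.dist y z + 2 * r :=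
      ⟨(G.dist x y + G.dist x z - G.dist y z) / 2, by omega⟩
    obtain ⟨a, ha₁, ha₂⟩ := exists_dist_eq hG (show r ≤ G.dist x y by omega)
    have p' := par x a z
    rw [comm a z] at p'
    obtain ⟨w, hx, hy, hz⟩ := exists_mem_three_balls hG hH (x := x) (y := y) (z := z) (r := r)
      (s := G.dist x y - r) (t := G.dist x z - r) (by omega) (by omega) (by omega) a
      (by rw [Nat.even_iff]; omega) (by rw [Nat.even_iff, comm y a]; omega)
      (by rw [Nat.even_iff]; omega)
    have s₁ := tri x w y
    have s₂ := tri x w z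
    have s₃ := tri y w z
    rw [comm w y] at s₁
    rw [comm w z] at s₂ s₃
    have e₁ : w = x := by
      have : w ∈ interval G x y ∩ interval G x z :=
        ⟨by rw [mem_interval, comm w y]; omega, by rw [mem_interval, comm w z]; omega⟩
      rwa [h₁] at this
    have e₂ : w = y := by
      have : w ∈ interval G y x ∩ interval G y z :=
        ⟨by rw [mem_interval, comm w x, comm y x]; omega, by rw [mem_interval, comm w z]; omega⟩
      rwa [h₂] at this
    have e₃ : w = z := by
      have : w ∈ interval G z x ∩ interval G z y :=
        ⟨by rw [mem_interval, comm w x, comm z x]; omega,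
          by rw [mem_interval, comm w y, comm z y]; omega⟩
      rwa [h₃] at this
    exact ⟨e₁.symm.trans e₂, e₂.symm.trans e₃⟩

/-- A bound on the distance to `x` for a vertex two steps from `u` towards `v`. -/
noncomputable def stepBound (G : SimpleGraph V) (u v x : V) : ℕ :=
  if G.dist x v = G.dist x u + G.dist u v then G.dist x u + 2
  else if G.dist x u = G.dist x v + G.dist u v then G.dist x u - 2
  else G.dist x u

theorem stepBound_add_stepBound_le {u v : V} (huv : 2 ≤ G.dist u v) (x : V) :
    stepBound G u v x + stepBound G v u x ≤ G.dist x u + G.dist x v := by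
  unfold stepBound
  rw [G.dist_comm (u := v) (v := u)]
  split_ifs <;> omega

theorem exists_dist_le_stepBound (hG : G.Connected) {c : G.Coloring Bool}
    (hH : HasHellyProperty (halfBalls G c)) {u v : V} (huv : 2 ≤ G.dist u v) {X : Set V}
    (hX : X.Finite) :
    ∃ s, G.dist u s ≤ 2 ∧ G.dist v s ≤ G.dist u v - 2 ∧
      ∀ x ∈ X, G.dist x s ≤ stepBound G u v x := by
  have comm := fun a b : V => G.dist_comm (u := a) (v := b)
  have tri := fun a b c : V => hG.dist_triangle (u := a) (v := b) (w := c)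
  have par := fun a b d : V => Nat.even_iff.1 (even_dist_add_dist_add_dist hG c a b d)
  have : Nontrivial V := ⟨u, v, fun he => by simp [he] at huv⟩
  obtain ⟨s, hs⟩ := exists_mem_balls hG hH
    -- The bounds at u and v themselves are 2 and d(u,v) − 2, which place s. Every bound has the
    -- parity of d(x,u), so all the half-balls lie in the color class of u.
    (S := (fun x => (x, stepBound G u v x)) '' insert u (insert v X))
    (((hX.insert v).insert u).image _) u (by
      rintro _ ⟨x, -, rfl⟩
      have := par x u v
      simp only [stepBound, Nat.even_iff]
      split_ifs <;> omega) (by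
      rintro _ ⟨x, -, rfl⟩ _ ⟨y, -, rfl⟩
      have p₁ := par x u v
      have p₂ := par y u v
      have t₁ := tri x u y
      have t₂ := tri x v y
      have t₃ := tri x u v
      have t₄ := tri y u v
      have t₅ := tri x v u
      have t₆ := tri y v u
      rw [comm u y] at t₁
      rw [comm v y] at t₂
      rw [comm v u] at t₅ t₆
      simp only [stepBound]
      split_ifs <;> omega)
  have hs' : ∀ x ∈ insert u (insert v X), G.dist x s ≤ stepBound G u v x :=
    fun x hx => hs _ ⟨x, hx, rfl⟩
  refine ⟨s, ?_, ?_, fun x hx => hs' x (by simp [hx])⟩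
  · have h := hs' u (by simp)
    simpa [stepBound] using h
  · have h := hs' v (by simp)
    simp only [stepBound, SimpleGraph.dist_self, comm v u] at h
    split_ifs at h <;> omega

theorem cost_add_cost_le {s : Multiset V} {a b u v : V}
    (h : ∀ x ∈ s, G.dist a x + G.dist b x ≤ G.dist u x + G.dist v x) :
    cost G s a + cost G s b ≤ cost G s u + cost G s v := by
  simp only [cost, ← Multiset.sum_map_add]
  exact Multiset.sum_map_le_sum_map _ _ h

theorem IsBipartiteHelly.hasPowerConnectedMedians (h : IsBipartiteHelly G) (hG : G.Connected) :
    HasPowerConnectedMedians G 2 := by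
  obtain ⟨c, hH⟩ := h
  intro π
  have comm := fun a b : V => G.dist_comm (u := a) (v := b)
  have key : ∀ n, ∀ u v : med G π, G.dist (u : V) v ≤ n →
      ((power G 2).induce (med G π)).Reachable u v := by
    intro n
    induction n using Nat.strong_induction_on with
    | _ n ih =>
    intro u v hn
    rcases eq_or_ne u v with rfl | hne
    · exact SimpleGraph.Reachable.refl _
    have adj : ∀ w : med G π, G.dist (u : V) w ≤ 2 →
        ((power G 2).induce (med G π)).Reachable u w := by
      intro w hw
      rcases eq_or_ne u w with rfl | hne
      · exact SimpleGraph.Reachable.refl _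
      · exact SimpleGraph.Adj.reachable ⟨fun he => hne (Subtype.ext he), hw⟩
    rcases le_or_gt (G.dist (u : V) v) 2 with hle | hlt
    · exact adj v hle
    obtain ⟨s, hs₁, hs₂, hs₃⟩ := exists_dist_le_stepBound hG hH hlt.le π.finite_toSet
    obtain ⟨t, ht₁, ht₂, ht₃⟩ := exists_dist_le_stepBound hG hH
      (show 2 ≤ G.dist (v : V) u by rw [comm]; exact hlt.le) π.finite_toSet
    -- For each x the bounds from the two ends add up to at most d(x,u) + d(x,v): a gain of 2 on one
    -- side pays for a loss of 2 on the other. Since u and v are both minimal, s is minimal too.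
    have hsum : cost G (π : Multiset V) s + cost G (π : Multiset V) t ≤
        cost G (π : Multiset V) u + cost G (π : Multiset V) v := by
      refine cost_add_cost_le fun x hx => ?_
      have h₁ := hs₃ x hx
      have h₂ := ht₃ x hx
      have h₃ := stepBound_add_stepBound_le hlt.le x
      rw [comm s, comm t, comm u, comm v]
      omega
    have hu := (mem_med_iff π _).1 u.2
    have hv := (mem_med_iff π _).1 v.2
    have hs : s ∈ med G π := by
      rw [mem_med_iff]
      intro w
      have h₁ := hv t
      have h₂ := hu w
      omega
    rw [comm] at hs₂
    exact (adj ⟨s, hs⟩ hs₁).trans (ih (n - 1) (by omega) ⟨s, hs⟩ v (by simp only; omega))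
  obtain ⟨v, hv⟩ := (med_isABCFunction hG).nonempty π
  have : Nonempty (med G π) := ⟨⟨v, hv⟩⟩
  exact ⟨fun u v => key _ u v le_rfl⟩

end ABCGraphs

theorem mainTheorem2 {V : Type*} (G : SimpleGraph V) (hG : G.Connected) :
    (ABCGraphs.IsModular G → ABCGraphs.HasPowerConnectedMedians G 2 →
      ABCGraphs.IsABCGraph G) ∧
    (ABCGraphs.IsBipartiteHelly G → ABCGraphs.IsABCGraph G) :=
  ⟨fun hm h => hm.isABCGraph hG h,
    fun h => (h.isModular hG).isABCGraph hG (h.hasPowerConnectedMedians hG)⟩
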